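/- Let $d,m$ be positive integers, $\xi\in\mathbb{R}^d$, $\tau\in\mathbb{R}^m$, let $\Omega\in\mathbb{R}^{d\times d}$ have positive diagonal entries, and let $\Delta\in\mathbb{R}^{d\times m}$, $\Gamma\in\mathbb{R}^{m\times m}$. Put $\omega=\mathrm{diag}(\Omega_{11}^{1/2},\dots,\Omega_{dd}^{1/2})$ and $\bar\Omega=\omega^{-1}\Omega\,\omega^{-1}$, and assume that $$\Omega^*=\begin{pmatrix}\bar\Omega&\Delta\\ \Delta^{\top}&\Gamma\end{pmatrix}$$ is a full-rank correlation matrix, that is, symmetric positive definite with unit diagonal. Let $(X_0,X_1)\sim \mathrm{N}_{d+m}(0,\Omega^*)$ with $X_0$ of dimension $d$ and $X_1$ of dimension $m$, let $Z$ be distributed as $X_0$ conditionally on the event $X_1+\tau>0$ (component-wise), and let $\mathrm{SUN}_{d,m}(\xi,\Omega,\Delta,\tau,\Gamma)$ denote the distribution of $Y=\xi+\omega Z$. Then $P=\mathrm{SUN}_{d,m}(\xi,\Omega,\Delta,\tau,\Gamma)$ is a log-concave probability measure on $\mathbb{R}^d$: it is a probability measure, and for all Borel sets $A,B\subseteq\mathbb{R}^d$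 and all $0<\lambda<1$, $$P\bigl(\lambda A+(1-\lambda)B\bigr)\;\ge\;P(A)^{\lambda}\,P(B)^{1-\lambda},$$ where $\lambda A+(1-\lambda)B=\{\lambda a+(1-\lambda)b: a\in A,\ b\in B\}$ (a universally measurable set, measured by the completion of $P$). -/

import Mathlib

open MeasureTheory ProbabilityTheory
open scoped Pointwise ENNReal

/-- A full-rank correlation matrix: symmetric positive definite with unit diagonal. -/
def IsFullRankCorrelation {ι : Type*} [Fintype ι] (M : Matrix ι ι ℝ) : Prop :=
  M.PosDef ∧ ∀ i, M i i = 1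

/-- The diagonal scale matrix `ω` of `Ω`, with `ω i i = √(Ω i i)`. -/
noncomputable def scaleMatrix {d : ℕ} (Ω : Matrix (Fin d) (Fin d) ℝ) :
    Matrix (Fin d) (Fin d) ℝ :=
  Matrix.diagonal fun i => Real.sqrt (Ω i i)

/-- The matrix `Ω̄ = ω⁻¹ Ω ω⁻¹`, so that `Ω = ω Ω̄ ω` when `Ω` has a positive diagonal. -/
noncomputable def scaledMatrix {d : ℕ} (Ω : Matrix (Fin d) (Fin d) ℝ) :
    Matrix (Fin d) (Fin d) ℝ :=
  (scaleMatrix Ω)⁻¹ * Ω * (scaleMatrix Ω)⁻¹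

/-- The block matrix `Ω* = [Ω̄, Δ; Δᵀ, Γ]`. -/
noncomputable def sunBlockMatrix {d m : ℕ} (Ω : Matrix (Fin d) (Fin d) ℝ)
    (Δ : Matrix (Fin d) (Fin m) ℝ) (Γ : Matrix (Fin m) (Fin m) ℝ) :
    Matrix (Fin d ⊕ Fin m) (Fin d ⊕ Fin m) ℝ :=
  Matrix.fromBlocks (scaledMatrix Ω) Δ Δ.transpose Γ

/-- Admissible matrix parameters of a SUN distribution: `Ω` has a positive diagonal and
`Ω*` is a full-rank correlation matrix. -/
structure IsSUNParameter {d m : ℕ} (Ω : Matrix (Fin d) (Fin d) ℝ)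
    (Δ : Matrix (Fin d) (Fin m) ℝ) (Γ : Matrix (Fin m) (Fin m) ℝ) : Prop where
  diag_pos : ∀ i, 0 < Ω i i
  correlation : IsFullRankCorrelation (sunBlockMatrix Ω Δ Γ)

/-- The event `X₁ + τ > 0` (component-wise), for `x = (X₀, X₁)`. -/
def sunEvent (d : ℕ) {m : ℕ} (τ : EuclideanSpace ℝ (Fin m)) :
    Set (EuclideanSpace ℝ (Fin d ⊕ Fin m)) :=
  {x | ∀ j : Fin m, 0 < x (Sum.inr j) + τ j}

/-- The map `(X₀, X₁) ↦ ξ + ω X₀`. -/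
noncomputable def sunMap {d : ℕ} (m : ℕ) (ξ : EuclideanSpace ℝ (Fin d))
    (Ω : Matrix (Fin d) (Fin d) ℝ) (x : EuclideanSpace ℝ (Fin d ⊕ Fin m)) :
    EuclideanSpace ℝ (Fin d) :=
  ξ + WithLp.toLp 2 ((scaleMatrix Ω).mulVec fun i => x (Sum.inl i))

/-- The distribution `SUN_{d,m}(ξ, Ω, Δ, τ, Γ)`: the law of `ξ + ω Z`, where `Z` is distributed
as `X₀` given `X₁ + τ > 0`, for `(X₀, X₁) ~ N_{d+m}(0, Ω*)`. -/
noncomputable def sunDistribution {d m : ℕ} (ξ : EuclideanSpace ℝ (Fin d))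
    (Ω : Matrix (Fin d) (Fin d) ℝ) (Δ : Matrix (Fin d) (Fin m) ℝ)
    (τ : EuclideanSpace ℝ (Fin m)) (Γ : Matrix (Fin m) (Fin m) ℝ) :
    Measure (EuclideanSpace ℝ (Fin d)) :=
  (cond (multivariateGaussian 0 (sunBlockMatrix Ω Δ Γ)) (sunEvent d τ)).map (sunMap m ξ Ω)

/-- Log-concavity of a measure: `P (λ A + (1 - λ) B) ≥ P(A) ^ λ * P(B) ^ (1 - λ)` for all Borel
sets `A`, `B` and all `0 < λ < 1`. The Minkowski combination need not be Borel, but it is analytic,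
hence universally measurable; on such sets the (outer) measure in Mathlib is the value of the
completion of `P`. -/
def IsLogConcaveMeasure {E : Type*} [AddCommGroup E] [Module ℝ E] [MeasurableSpace E]
    (P : Measure E) : Prop :=
  ∀ A B : Set E, MeasurableSet A → MeasurableSet B → ∀ l : ℝ, 0 < l → l < 1 →
    P A ^ l * P B ^ (1 - l) ≤ P (l • A + (1 - l) • B)

/-! The Gaussian law `multivariateGaussian 0 S` is an affine image of independent standard normals.
Each of these satisfies Prékopa–Leindler, since its density is log-concave and Lebesgue measure on
the line satisfies the inequality (`prekopaLeindler_real`). The functional form passes to products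
by Fubini, and indicators then give log-concavity of the measure. Conditioning on a convex event of
positive mass and applying an affine map both preserve log-concavity. `sunEvent` is convex, and its
mass is positive because it is open and nonempty and a Gaussian with positive definite covariance
charges every such set. -/

/-- The Prékopa–Leindler inequality for integrals with respect to `μ`. -/
def SatisfiesPrekopaLeindler {E : Type*} [AddCommGroup E] [Module ℝ E] [MeasurableSpace E]
    (μ : Measure E) : Prop :=
  ∀ l : ℝ, 0 < l → l < 1 → ∀ f g h : E → ℝ≥0∞, Measurable f → Measurable g → Measurable h →
    (∀ x y, f x ^ l * g y ^ (1 - l) ≤ h (l • x + (1 - l) • y)) →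
    (∫⁻ x, f x ∂μ) ^ l * (∫⁻ x, g x ∂μ) ^ (1 - l) ≤ ∫⁻ x, h x ∂μ

/-! ### Brunn–Minkowski on the line. -/

/-- The translates `min B + A` and `max A + B` both lie in `A + B` and can meet only at `max A + min
B`. -/
theorem IsCompact.volume_add_volume_le {A B : Set ℝ} (hA : IsCompact A) (hB : IsCompact B)
    (hA' : A.Nonempty) (hB' : B.Nonempty) : volume A + volume B ≤ volume (A + B) := by
  obtain ⟨a, ha⟩ := hA.exists_isGreatest hA'
  obtain ⟨b, hb⟩ := hB.exists_isLeast hB'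
  have hinter : ((b +ᵥ A) ∩ (a +ᵥ B)) ⊆ {a + b} := by
    rintro _ ⟨⟨x, hx, rfl⟩, ⟨y, hy, hxy⟩⟩
    have h1 := ha.2 hx
    have h2 := hb.2 hy
    simp only [vadd_eq_add, Set.mem_singleton_iff] at *
    linarith
  have hdisj : AEDisjoint volume (b +ᵥ A) (a +ᵥ B) :=
    measure_mono_null hinter (by simp)
  calc volume A + volume B = volume (b +ᵥ A) + volume (a +ᵥ B) := by
        rw [measure_vadd, measure_vadd]
    _ = volume ((b +ᵥ A) ∪ (a +ᵥ B)) :=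
        (measure_union₀ (hB.vadd a).measurableSet.nullMeasurableSet hdisj).symm
    _ ≤ volume (A + B) := by
        refine measure_mono (Set.union_subset ?_ ?_)
        · rintro _ ⟨x, hx, rfl⟩
          exact ⟨x, hx, b, hb.1, add_comm _ _⟩
        · rintro _ ⟨y, hy, rfl⟩
          exact ⟨a, ha.1, y, hy, rfl⟩

theorem MeasurableSet.volume_add_volume_le {A B : Set ℝ} (hA : MeasurableSet A)
    (hB : MeasurableSet B) (hA' : A.Nonempty) (hB' : B.Nonempty) :
    volume A + volume B ≤ volume (A + B) := by
  obtain ⟨a, ha⟩ := hA'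
  obtain ⟨b, hb⟩ := hB'
  have hreg : ∀ D : Set ℝ, MeasurableSet D →
      volume D = ⨆ K, ⨆ (_ : K ⊆ D ∧ IsCompact K), volume K := fun D hD => by
    simpa only [iSup_and] using hD.measure_eq_iSup_isCompact volume
  rw [hreg A hA, hreg B hB]
  have hab : ∀ K L : Set ℝ, (K ⊆ A ∧ IsCompact K) → (L ⊆ B ∧ IsCompact L) →
      volume K + volume L ≤ volume (A + B) := by
    rintro K L ⟨hKA, hK⟩ ⟨hLB, hL⟩
    -- A compact subset may be empty; adjoining a point of `A` or `B` makes the compact case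
    -- applicable.
    calc volume K + volume L ≤ volume (insert a K) + volume (insert b L) := by
          gcongr <;> exact Set.subset_insert _ _
      _ ≤ volume (insert a K + insert b L) := (hK.insert a).volume_add_volume_le (hL.insert b)
          (Set.insert_nonempty _ _) (Set.insert_nonempty _ _)
      _ ≤ volume (A + B) := measure_mono <|
          Set.add_subset_add (Set.insert_subset ha hKA) (Set.insert_subset hb hLB)
  exact ENNReal.biSup_add_biSup_le' ⟨∅, by simp⟩ ⟨∅, by simp⟩ fun K hK L hL => hab K L hK hL

theorem volume_convexCombination_le {A B C : Set ℝ} (hA : MeasurableSet A)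
    (hB : MeasurableSet B) (hA' : A.Nonempty) (hB' : B.Nonempty) {l : ℝ} (h0 : 0 < l) (h1 : l < 1)
    (hC : ∀ x ∈ A, ∀ y ∈ B, l * x + (1 - l) * y ∈ C) :
    ENNReal.ofReal l * volume A + ENNReal.ofReal (1 - l) * volume B ≤ volume C := by
  have h2 : 0 < 1 - l := by linarith
  calc _ = volume (l • A) + volume ((1 - l) • B) := by
        simp [Measure.addHaar_smul, abs_of_pos h0, abs_of_pos h2]
    _ ≤ volume (l • A + (1 - l) • B) :=
        (hA.const_smul₀ l).volume_add_volume_le (hB.const_smul₀ (1 - l)) hA'.smul_set hB'.smul_set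
    _ ≤ volume C := by
        refine measure_mono ?_
        rintro _ ⟨_, ⟨x, hx, rfl⟩, _, ⟨y, hy, rfl⟩, rfl⟩
        exact hC x hx y hy

/-! ### Prékopa–Leindler on the line. -/

/-- The layer cake argument: for functions with supremum one, the Prékopa–Leindler inequality
holds in its additive form. -/
theorem lintegral_convexCombination_le {f g h : ℝ → ℝ} (hf : Measurable f) (hg : Measurable g)
    (hh : Measurable h) (f0 : ∀ x, 0 ≤ f x) (g0 : ∀ x, 0 ≤ g x) (h0 : ∀ x, 0 ≤ h x)
    (f1 : ∀ x, f x ≤ 1) (g1 : ∀ x, g x ≤ 1) (hfs : ∀ t < 1, ∃ x, t < f x)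
    (hgs : ∀ t < 1, ∃ x, t < g x) {l : ℝ} (l0 : 0 < l) (l1 : l < 1)
    (hfg : ∀ t x y, 0 < t → t < f x → t < g y → t < h (l * x + (1 - l) * y)) :
    ENNReal.ofReal l * (∫⁻ x, ENNReal.ofReal (f x)) +
      ENNReal.ofReal (1 - l) * (∫⁻ x, ENNReal.ofReal (g x)) ≤ ∫⁻ x, ENNReal.ofReal (h x) := by
  rw [lintegral_eq_lintegral_meas_lt _ (.of_forall f0) hf.aemeasurable,
    lintegral_eq_lintegral_meas_lt _ (.of_forall g0) hg.aemeasurable,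
    lintegral_eq_lintegral_meas_lt _ (.of_forall h0) hh.aemeasurable,
    ← lintegral_const_mul' _ _ ENNReal.ofReal_ne_top,
    ← lintegral_const_mul' _ _ ENNReal.ofReal_ne_top]
  refine (le_lintegral_add _ _).trans (setLIntegral_mono' measurableSet_Ioi fun t ht => ?_)
  -- The common supremum 1 makes both level sets nonempty below level 1, as Brunn–Minkowski
  -- requires, and both empty from level 1 on.
  rcases lt_or_ge t 1 with ht1 | ht1
  · exact volume_convexCombination_le (measurableSet_lt measurable_const hf)
      (measurableSet_lt measurable_const hg) (hfs t ht1) (hgs t ht1) l0 l1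
      fun x hx y hy => hfg t x y ht hx hy
  · have hf' : {x | t < f x} = ∅ := Set.eq_empty_of_forall_notMem fun x hx =>
      absurd (f1 x) (not_le.2 (ht1.trans_lt hx))
    have hg' : {x | t < g x} = ∅ := Set.eq_empty_of_forall_notMem fun x hx =>
      absurd (g1 x) (not_le.2 (ht1.trans_lt hx))
    simp [hf', hg']

theorem ENNReal.rpow_mul_rpow_le_add {l : ℝ} (l0 : 0 < l) (l1 : l < 1) (a b : ℝ≥0∞) :
    a ^ l * b ^ (1 - l) ≤ ENNReal.ofReal l * a + ENNReal.ofReal (1 - l) * b := by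
  have h2 : 0 < 1 - l := by linarith
  have hpq : (l⁻¹).HolderConjugate (1 - l)⁻¹ := by
    rw [Real.holderConjugate_iff]
    exact ⟨(one_lt_inv₀ l0).2 l1, by simp⟩
  have := ENNReal.young_inequality (a ^ l) (b ^ (1 - l)) hpq
  rwa [← ENNReal.rpow_mul, ← ENNReal.rpow_mul, mul_inv_cancel₀ l0.ne', mul_inv_cancel₀ h2.ne',
    ENNReal.rpow_one, ENNReal.rpow_one, ENNReal.ofReal_inv_of_pos l0, ENNReal.ofReal_inv_of_pos h2,
    div_eq_mul_inv, div_eq_mul_inv, inv_inv, inv_inv, mul_comm a, mul_comm b] at this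

/-- Prékopa–Leindler on the line for bounded functions. -/
theorem prekopaLeindler_real_of_bounded {f g h : ℝ → ℝ≥0∞} (hf : Measurable f)
    (hg : Measurable g) (hh : Measurable h) {l : ℝ} (l0 : 0 < l) (l1 : l < 1)
    (hfb : ⨆ x, f x ≠ ∞) (hgb : ⨆ x, g x ≠ ∞)
    (hfg : ∀ x y, f x ^ l * g y ^ (1 - l) ≤ h (l * x + (1 - l) * y)) :
    (∫⁻ x, f x) ^ l * (∫⁻ x, g x) ^ (1 - l) ≤ ∫⁻ x, h x := by
  have l2 : 0 < 1 - l := by linarith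
  set a := ⨆ x, f x with ha
  set b := ⨆ x, g x with hb
  have hfa : ∀ x, f x ≤ a := le_iSup f
  have hgb' : ∀ x, g x ≤ b := le_iSup g
  rcases eq_or_ne a 0 with ha0 | ha0
  · have : ∀ x, f x = 0 := fun x => le_antisymm ((hfa x).trans_eq ha0) zero_le
    simp [this, l0]
  rcases eq_or_ne b 0 with hb0 | hb0
  · have : ∀ x, g x = 0 := fun x => le_antisymm ((hgb' x).trans_eq hb0) zero_le
    simp [this, l1]
  set c := a ^ l * b ^ (1 - l) with hc
  have hc0 : c ≠ 0 := mul_ne_zero (by simp [ha0, l0.not_gt, hfb]) (by simp [hb0, l2.not_gt, hgb])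
  have hct : c ≠ ∞ := ENNReal.mul_ne_top (ENNReal.rpow_ne_top_of_nonneg l0.le hfb)
    (ENNReal.rpow_ne_top_of_nonneg l2.le hgb)
  have hdiv : ∀ u v : ℝ≥0∞, (u / a) ^ l * (v / b) ^ (1 - l) = u ^ l * v ^ (1 - l) / c := by
    intro u v
    rw [ENNReal.div_rpow_of_nonneg _ _ l0.le, ENNReal.div_rpow_of_nonneg _ _ l2.le, hc,
      div_eq_mul_inv, div_eq_mul_inv, div_eq_mul_inv, ENNReal.mul_inv, mul_mul_mul_comm]
    · exact Or.inr (ENNReal.rpow_ne_top_of_nonneg l2.le hgb)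
    · exact Or.inl (ENNReal.rpow_ne_top_of_nonneg l0.le hfb)
  have hf1 : ∀ x, f x / a ≤ 1 := fun x => ENNReal.div_le_of_le_mul (by simpa using hfa x)
  have hg1 : ∀ x, g x / b ≤ 1 := fun x => ENNReal.div_le_of_le_mul (by simpa using hgb' x)
  have hsup : ∀ (u : ℝ → ℝ≥0∞) (s : ℝ≥0∞), s = ⨆ x, u x → s ≠ 0 → s ≠ ∞ → ∀ t < (1 : ℝ),
      ∃ x, u x / s ≤ 1 → t < (u x / s).toReal := by
    intro u s hs hs0 hst t ht
    have h1 : ENNReal.ofReal t * s < ⨆ x, u x := by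
      rw [← hs]
      calc ENNReal.ofReal t * s < 1 * s :=
            ENNReal.mul_lt_mul_left hs0 hst (by simpa using ht)
        _ = s := one_mul s
    obtain ⟨x, hx⟩ := lt_iSup_iff.1 h1
    refine ⟨x, fun hx1 => ?_⟩
    by_contra! hle
    have hlt := (ENNReal.lt_div_iff_mul_lt (Or.inl hs0) (Or.inl hst)).2 hx
    rw [← ENNReal.ofReal_toReal (ne_top_of_le_ne_top ENNReal.one_ne_top hx1)] at hlt
    exact hlt.not_ge (ENNReal.ofReal_le_ofReal hle)
  -- Dividing by `a`, `b` and `c = a ^ l * b ^ (1 - l)` preserves the hypothesis. Capping `h / c` at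
  -- 1 keeps `toReal` faithful where `h` is infinite and loses nothing, as only levels below 1
  -- matter.
  have key := lintegral_convexCombination_le (f := fun x => (f x / a).toReal)
    (g := fun x => (g x / b).toReal) (h := fun x => (min (h x / c) 1).toReal)
    (by fun_prop) (by fun_prop) (by fun_prop) (fun _ => ENNReal.toReal_nonneg)
    (fun _ => ENNReal.toReal_nonneg) (fun _ => ENNReal.toReal_nonneg)
    (fun x => ENNReal.toReal_le_of_le_ofReal zero_le_one (by simpa using hf1 x))
    (fun x => ENNReal.toReal_le_of_le_ofReal zero_le_one (by simpa using hg1 x))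
    (fun t ht => (hsup f a ha ha0 hfb t ht).imp fun x hx => hx (hf1 x))
    (fun t ht => (hsup g b hb hb0 hgb t ht).imp fun x hx => hx (hg1 x)) l0 l1 ?_
  · have e1 : ∀ x, ENNReal.ofReal (f x / a).toReal = f x / a := fun x =>
      ENNReal.ofReal_toReal (ne_top_of_le_ne_top ENNReal.one_ne_top (hf1 x))
    have e2 : ∀ x, ENNReal.ofReal (g x / b).toReal = g x / b := fun x =>
      ENNReal.ofReal_toReal (ne_top_of_le_ne_top ENNReal.one_ne_top (hg1 x))
    simp only [e1, e2] at key
    -- Weighted AM–GM turns the additive bound into the multiplicative one.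
    have key2 := (ENNReal.rpow_mul_rpow_le_add l0 l1 _ _).trans (key.trans
      (lintegral_mono (g := fun x => h x / c) fun x =>
        ENNReal.ofReal_toReal_le.trans (min_le_left _ _)))
    simp only [div_eq_mul_inv] at key2
    rw [lintegral_mul_const _ hf, lintegral_mul_const _ hg, lintegral_mul_const _ hh] at key2
    simp only [← div_eq_mul_inv] at key2
    rw [hdiv] at key2
    rwa [ENNReal.div_le_iff hc0 hct, ENNReal.div_mul_cancel hc0 hct] at key2
  · intro t x y ht htx hty
    have hs0 : ENNReal.ofReal t ≠ 0 := by simpa using ht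
    rw [← ENNReal.ofReal_lt_iff_lt_toReal ht.le
      (ne_top_of_le_ne_top ENNReal.one_ne_top (hf1 x))] at htx
    rw [← ENNReal.ofReal_lt_iff_lt_toReal ht.le
      (ne_top_of_le_ne_top ENNReal.one_ne_top (hg1 y))] at hty
    rw [← ENNReal.ofReal_lt_iff_lt_toReal ht.le
      (ne_top_of_le_ne_top ENNReal.one_ne_top (min_le_right _ _))]
    refine lt_min ?_ (htx.trans_le (hf1 x))
    calc ENNReal.ofReal t = ENNReal.ofReal t ^ l * ENNReal.ofReal t ^ (1 - l) := by
          rw [← ENNReal.rpow_add _ _ hs0 ENNReal.ofReal_ne_top]; simp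
      _ < (f x / a) ^ l * (g y / b) ^ (1 - l) :=
          ENNReal.mul_lt_mul (ENNReal.rpow_lt_rpow htx l0) (ENNReal.rpow_lt_rpow hty l2)
      _ = f x ^ l * g y ^ (1 - l) / c := hdiv _ _
      _ ≤ h (l * x + (1 - l) * y) / c := by gcongr; exact hfg x y

theorem prekopaLeindler_real : SatisfiesPrekopaLeindler (volume : Measure ℝ) := by
  intro l l0 l1 f g h hf hg hh hfg
  have l2 : 0 < 1 - l := by linarith
  -- With both integrals nonzero, the limit of the products below cannot take the form `0 * ∞`.
  rcases eq_or_ne (∫⁻ x, f x) 0 with hf0 | hf0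
  · simp [hf0, l0]
  rcases eq_or_ne (∫⁻ x, g x) 0 with hg0 | hg0
  · simp [hg0, l1]
  have htrunc : ∀ u : ℝ → ℝ≥0∞, Measurable u → Filter.Tendsto
      (fun n : ℕ => ∫⁻ x, min (u x) n) Filter.atTop (nhds (∫⁻ x, u x)) := by
    intro u hu
    refine lintegral_tendsto_of_tendsto_of_monotone
      (fun n => (hu.min measurable_const).aemeasurable)
      (.of_forall fun x m n hmn => min_le_min_left _ (by exact_mod_cast hmn))
      (.of_forall fun x => ?_)
    simpa using (tendsto_const_nhds (x := u x)).min ENNReal.tendsto_nat_nhds_top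
  have hlim := ENNReal.Tendsto.mul
    ((ENNReal.continuous_rpow_const (y := l)).continuousAt.tendsto.comp (htrunc f hf))
    (Or.inl (by simp [hf0, l0, l0.not_gt]))
    ((ENNReal.continuous_rpow_const (y := 1 - l)).continuousAt.tendsto.comp (htrunc g hg))
    (Or.inl (by simp [hg0, l1, l2.not_gt]))
  refine le_of_tendsto' hlim fun n => ?_
  refine prekopaLeindler_real_of_bounded (hf.min measurable_const) (hg.min measurable_const) hh
    l0 l1 (ne_top_of_le_ne_top (ENNReal.natCast_ne_top n) (iSup_le fun x => min_le_right _ _))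
    (ne_top_of_le_ne_top (ENNReal.natCast_ne_top n) (iSup_le fun x => min_le_right _ _))
    fun x y => le_trans ?_ (hfg x y)
  gcongr <;> exact min_le_left _ _
-- One-dimensional Gaussian measures.
theorem gaussianPDF_rpow_mul_rpow_le (μ : ℝ) (v : NNReal) {l : ℝ} (l0 : 0 < l) (l1 : l < 1)
    (x y : ℝ) : gaussianPDF μ v x ^ l * gaussianPDF μ v y ^ (1 - l) ≤
      gaussianPDF μ v (l * x + (1 - l) * y) := by
  have l2 : 0 < 1 - l := by linarith
  rw [gaussianPDF, gaussianPDF, gaussianPDF,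
    ENNReal.ofReal_rpow_of_nonneg (gaussianPDFReal_nonneg _ _ _) l0.le,
    ENNReal.ofReal_rpow_of_nonneg (gaussianPDFReal_nonneg _ _ _) l2.le,
    ← ENNReal.ofReal_mul (Real.rpow_nonneg (gaussianPDFReal_nonneg _ _ _) _)]
  refine ENNReal.ofReal_le_ofReal ?_
  simp only [gaussianPDFReal]
  have hc : 0 ≤ (√(2 * Real.pi * v))⁻¹ := by positivity
  generalize (√(2 * Real.pi * v))⁻¹ = c at hc ⊢
  rw [Real.mul_rpow hc (Real.exp_nonneg _), Real.mul_rpow hc (Real.exp_nonneg _),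
    ← Real.exp_mul, ← Real.exp_mul, mul_mul_mul_comm, ← Real.exp_add,
    ← Real.rpow_add_of_nonneg hc l0.le l2.le, add_sub_cancel, Real.rpow_one]
  gcongr
  -- The two sides differ by exactly `l * (1 - l) * (x - y) ^ 2`.
  have hsq : (l * x + (1 - l) * y - μ) ^ 2 ≤ l * (x - μ) ^ 2 + (1 - l) * (y - μ) ^ 2 := by
    nlinarith [mul_nonneg (mul_nonneg l0.le l2.le) (sq_nonneg (x - y))]
  calc _ = -(l * (x - μ) ^ 2 + (1 - l) * (y - μ) ^ 2) / (2 * v) := by ring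
    _ ≤ _ := by gcongr

theorem satisfiesPrekopaLeindler_gaussianReal (μ : ℝ) {v : NNReal} (hv : v ≠ 0) :
    SatisfiesPrekopaLeindler (gaussianReal μ v) := by
  intro l l0 l1 f g h hf hg hh hfg
  have l2 : 0 < 1 - l := by linarith
  have hp := measurable_gaussianPDF μ v
  rw [gaussianReal_of_var_ne_zero _ hv, lintegral_withDensity_eq_lintegral_mul _ hp hf,
    lintegral_withDensity_eq_lintegral_mul _ hp hg, lintegral_withDensity_eq_lintegral_mul _ hp hh]
  refine prekopaLeindler_real l l0 l1 _ _ _ (hp.mul hf) (hp.mul hg) (hp.mul hh) fun x y => ?_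
  simp only [Pi.mul_apply]
  rw [ENNReal.mul_rpow_of_nonneg _ _ l0.le, ENNReal.mul_rpow_of_nonneg _ _ l2.le,
    mul_mul_mul_comm]
  exact mul_le_mul' (gaussianPDF_rpow_mul_rpow_le μ v l0 l1 x y) (hfg x y)

/-! ### Stability under products, affine images and conditioning. -/

section

variable {E F : Type*} [AddCommGroup E] [Module ℝ E] [MeasurableSpace E]
  [AddCommGroup F] [Module ℝ F] [MeasurableSpace F]

/-- For fixed `x` and `y`, the inequality for `ν` on the fibres is the hypothesis needed to apply
that for `μ` to the fibre integrals. -/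
theorem SatisfiesPrekopaLeindler.prod {μ : Measure E} {ν : Measure F} [SFinite ν]
    (hμ : SatisfiesPrekopaLeindler μ) (hν : SatisfiesPrekopaLeindler ν) :
    SatisfiesPrekopaLeindler (μ.prod ν) := by
  intro l l0 l1 f g h hf hg hh hfg
  rw [lintegral_prod _ hf.aemeasurable, lintegral_prod _ hg.aemeasurable,
    lintegral_prod _ hh.aemeasurable]
  refine hμ l l0 l1 _ _ _ hf.lintegral_prod_right' hg.lintegral_prod_right'
    hh.lintegral_prod_right' fun x y => ?_
  exact hν l l0 l1 _ _ _ (hf.comp measurable_prodMk_left) (hg.comp measurable_prodMk_left)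
    (hh.comp measurable_prodMk_left) fun u w => hfg (x, u) (y, w)

theorem SatisfiesPrekopaLeindler.map {μ : Measure E} (hμ : SatisfiesPrekopaLeindler μ)
    {T : E → F} (hT : Measurable T)
    (hconv : ∀ (l : ℝ) (x y : E), T (l • x + (1 - l) • y) = l • T x + (1 - l) • T y) :
    SatisfiesPrekopaLeindler (μ.map T) := by
  intro l l0 l1 f g h hf hg hh hfg
  rw [lintegral_map hf hT, lintegral_map hg hT, lintegral_map hh hT]
  refine hμ l l0 l1 _ _ _ (hf.comp hT) (hg.comp hT) (hh.comp hT) fun x y => ?_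
  rw [hconv]
  exact hfg _ _

theorem SatisfiesPrekopaLeindler.isLogConcaveMeasure {μ : Measure E}
    (hμ : SatisfiesPrekopaLeindler μ) : IsLogConcaveMeasure μ := by
  intro A B hA hB l l0 l1
  have l2 : 0 < 1 - l := by linarith
  -- The Minkowski combination need not be measurable; its measurable hull has the same outer
  -- measure.
  set C := toMeasurable μ (l • A + (1 - l) • B) with hC
  have hCm : MeasurableSet C := measurableSet_toMeasurable _ _
  have key := hμ l l0 l1 (A.indicator 1) (B.indicator 1) (C.indicator 1)
    (measurable_one.indicator hA) (measurable_one.indicator hB) (measurable_one.indicator hCm) ?_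
  · rwa [lintegral_indicator_one hA, lintegral_indicator_one hB, lintegral_indicator_one hCm, hC,
      measure_toMeasurable] at key
  · intro x y
    by_cases hx : x ∈ A
    · by_cases hy : y ∈ B
      · have : l • x + (1 - l) • y ∈ C := subset_toMeasurable _ _
          (Set.add_mem_add (Set.smul_mem_smul_set hx) (Set.smul_mem_smul_set hy))
        simp [hx, hy, this]
      · simp [hy, l1]
    · simp [hx, l0]

theorem IsLogConcaveMeasure.map {P : Measure E} (hP : IsLogConcaveMeasure P)
    {T : E → F} (hT : Measurable T)
    (hconv : ∀ (l : ℝ) (x y : E), T (l • x + (1 - l) • y) = l • T x + (1 - l) • T y) :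
    IsLogConcaveMeasure (P.map T) := by
  intro A B hA hB l l0 l1
  rw [Measure.map_apply hT hA, Measure.map_apply hT hB]
  refine (hP _ _ (hT hA) (hT hB) l l0 l1).trans
    ((measure_mono ?_).trans (Measure.le_map_apply hT.aemeasurable _))
  rintro _ ⟨_, ⟨x, hx, rfl⟩, _, ⟨y, hy, rfl⟩, rfl⟩
  simp only [Set.mem_preimage]
  rw [hconv]
  exact Set.add_mem_add (Set.smul_mem_smul_set hx) (Set.smul_mem_smul_set hy)

theorem IsLogConcaveMeasure.restrict {P : Measure E} (hP : IsLogConcaveMeasure P) {C : Set E}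
    (hC : MeasurableSet C) (hconv : Convex ℝ C) : IsLogConcaveMeasure (P.restrict C) := by
  intro A B hA hB l l0 l1
  rw [Measure.restrict_apply hA, Measure.restrict_apply hB, Measure.restrict_apply' hC]
  refine (hP _ _ (hA.inter hC) (hB.inter hC) l l0 l1).trans (measure_mono ?_)
  rintro _ ⟨_, ⟨x, hx, rfl⟩, _, ⟨y, hy, rfl⟩, rfl⟩
  exact ⟨Set.add_mem_add (Set.smul_mem_smul_set hx.1) (Set.smul_mem_smul_set hy.1),
    hconv hx.2 hy.2 l0.le (by linarith) (by ring)⟩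

theorem IsLogConcaveMeasure.smul {P : Measure E} (hP : IsLogConcaveMeasure P) {c : ℝ≥0∞}
    (hc0 : c ≠ 0) (hct : c ≠ ∞) : IsLogConcaveMeasure (c • P) := by
  intro A B hA hB l l0 l1
  have l2 : 0 < 1 - l := by linarith
  simp only [Measure.smul_apply, smul_eq_mul]
  rw [ENNReal.mul_rpow_of_nonneg _ _ l0.le, ENNReal.mul_rpow_of_nonneg _ _ l2.le,
    mul_mul_mul_comm, ← ENNReal.rpow_add _ _ hc0 hct, add_sub_cancel, ENNReal.rpow_one]
  gcongr
  exact hP A B hA hB l l0 l1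

theorem IsLogConcaveMeasure.cond {P : Measure E} [IsFiniteMeasure P]
    (hP : IsLogConcaveMeasure P) {C : Set E} (hC : MeasurableSet C) (hconv : Convex ℝ C)
    (hC0 : P C ≠ 0) : IsLogConcaveMeasure (ProbabilityTheory.cond P C) :=
  (hP.restrict hC hconv).smul (by simp) (by simpa using hC0)

end

/-! ### Multivariate Gaussian measures. -/

theorem satisfiesPrekopaLeindler_pi_gaussianReal (n : ℕ) :
    SatisfiesPrekopaLeindler (Measure.pi fun _ : Fin n => gaussianReal 0 1) := by
  induction n with
  | zero =>
    intro l l0 l1 f g h hf hg hh hfg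
    rw [Measure.pi_of_empty, lintegral_dirac' _ hf, lintegral_dirac' _ hg, lintegral_dirac' _ hh]
    convert hfg _ _ using 2
  | succ n ih =>
    have hmp := (measurePreserving_piFinSuccAbove
      (fun _ : Fin (n + 1) => gaussianReal 0 1) 0).symm
    rw [← hmp.map_eq]
    refine ((satisfiesPrekopaLeindler_gaussianReal 0 one_ne_zero).prod ih).map
      hmp.measurable fun l x y => ?_
    ext i
    refine Fin.cases ?_ (fun i => ?_) i <;> simp [MeasurableEquiv.piFinSuccAbove]

theorem isLogConcaveMeasure_multivariateGaussian {ι : Type*} [Fintype ι] [DecidableEq ι]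
    (S : Matrix ι ι ℝ) : IsLogConcaveMeasure (multivariateGaussian 0 S) := by
  refine ((satisfiesPrekopaLeindler_pi_gaussianReal _).isLogConcaveMeasure.map
    (by fun_prop) fun l x y => ?_).map (by fun_prop) fun l x y => ?_
  · simp [add_smul, Finset.sum_add_distrib, Finset.smul_sum, smul_smul]
  · simp

instance isOpenPosMeasure_stdGaussian {ι : Type*} [Fintype ι] :
    (stdGaussian (EuclideanSpace ℝ ι)).IsOpenPosMeasure := by
  have : (gaussianReal 0 1).IsOpenPosMeasure :=
    (gaussianReal_absolutelyContinuous' 0 one_ne_zero).isOpenPosMeasure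
  rw [← map_pi_eq_stdGaussian]
  exact (PiLp.continuous_toLp 2 _).isOpenPosMeasure_map (WithLp.toLp_surjective 2)

open scoped MatrixOrder in
theorem isOpenPosMeasure_multivariateGaussian {ι : Type*} [Fintype ι] [DecidableEq ι]
    {S : Matrix ι ι ℝ} (hS : S.PosDef) : (multivariateGaussian 0 S).IsOpenPosMeasure := by
  have hsq : CFC.sqrt S * CFC.sqrt S = S := CFC.sqrt_mul_sqrt_self S hS.posSemidef.nonneg
  refine Continuous.isOpenPosMeasure_map (by fun_prop) fun y => ?_
  -- Surjectivity of `CFC.sqrt S`: a preimage of `y` is `CFC.sqrt S * S⁻¹` applied to `y`.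
  refine ⟨Matrix.toEuclideanCLM (𝕜 := ℝ) (CFC.sqrt S * S⁻¹) y, ?_⟩
  rw [zero_add, ← mul_apply_eq_comp, ← map_mul, ← mul_assoc, hsq,
    Matrix.mul_nonsing_inv _ ((Matrix.isUnit_iff_isUnit_det _).1 hS.isUnit), map_one]
  rfl

/-! ### The conditioning event and the affine map of the SUN law. -/

theorem isOpen_sunEvent (d : ℕ) {m : ℕ} (τ : EuclideanSpace ℝ (Fin m)) :
    IsOpen (sunEvent d τ) := by
  simp only [sunEvent, Set.ofPred_forall]
  exact isOpen_iInter_of_finite fun j => isOpen_lt continuous_const (by fun_prop)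

theorem convex_sunEvent (d : ℕ) {m : ℕ} (τ : EuclideanSpace ℝ (Fin m)) :
    Convex ℝ (sunEvent d τ) := by
  intro x hx y hy a b ha hb hab j
  have h1 := hx j
  have h2 := hy j
  have h3 : (a • x + b • y) (Sum.inr j) + τ j =
      a * (x (Sum.inr j) + τ j) + b * (y (Sum.inr j) + τ j) := by
    simp only [PiLp.add_apply, PiLp.smul_apply, smul_eq_mul]
    linear_combination (-τ j) * hab
  rw [h3]
  rcases ha.eq_or_lt with rfl | ha
  · have : b = 1 := by linarith
    simpa [this] using h2
  · exact add_pos_of_pos_of_nonneg (mul_pos ha h1) (mul_nonneg hb h2.le)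

theorem nonempty_sunEvent (d : ℕ) {m : ℕ} (τ : EuclideanSpace ℝ (Fin m)) :
    (sunEvent d τ).Nonempty :=
  ⟨WithLp.toLp 2 (Sum.elim 0 fun j => 1 - τ j), fun j => by simp⟩

theorem continuous_sunMap {d : ℕ} (m : ℕ) (ξ : EuclideanSpace ℝ (Fin d))
    (Ω : Matrix (Fin d) (Fin d) ℝ) : Continuous (sunMap m ξ Ω) := by
  unfold sunMap
  fun_prop

theorem sunMap_convexCombination {d : ℕ} (m : ℕ) (ξ : EuclideanSpace ℝ (Fin d))
    (Ω : Matrix (Fin d) (Fin d) ℝ) (l : ℝ) (x y : EuclideanSpace ℝ (Fin d ⊕ Fin m)) :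
    sunMap m ξ Ω (l • x + (1 - l) • y) = l • sunMap m ξ Ω x + (1 - l) • sunMap m ξ Ω y := by
  ext i
  simp only [sunMap, scaleMatrix, Matrix.mulVec_diagonal, PiLp.add_apply, PiLp.smul_apply,
    smul_eq_mul]
  ring

theorem mainTheorem3 {d m : ℕ} (hd : 0 < d) (hm : 0 < m)
    (ξ : EuclideanSpace ℝ (Fin d)) (Ω : Matrix (Fin d) (Fin d) ℝ)
    (Δ : Matrix (Fin d) (Fin m) ℝ) (τ : EuclideanSpace ℝ (Fin m))
    (Γ : Matrix (Fin m) (Fin m) ℝ) (hpar : IsSUNParameter Ω Δ Γ) :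
    IsProbabilityMeasure (sunDistribution ξ Ω Δ τ Γ) ∧
      IsLogConcaveMeasure (sunDistribution ξ Ω Δ τ Γ) := by
  have := isOpenPosMeasure_multivariateGaussian hpar.correlation.1
  have h0 : multivariateGaussian 0 (sunBlockMatrix Ω Δ Γ) (sunEvent d τ) ≠ 0 :=
    ((isOpen_sunEvent d τ).measure_pos _ (nonempty_sunEvent d τ)).ne'
  have hmeas := (continuous_sunMap m ξ Ω).measurable
  have := cond_isProbabilityMeasure h0
  exact ⟨Measure.isProbabilityMeasure_map hmeas.aemeasurable,
    ((isLogConcaveMeasure_multivariateGaussian _).cond (isOpen_sunEvent d τ).measurableSet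
      (convex_sunEvent d τ) h0).map hmeas (sunMap_convexCombination m ξ Ω)⟩
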